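/- Let $m,n\ge 1$ be integers, let $S,W,A\in\mathbb{R}^{m\times n}$, put $X^*:=S+W$, and let $\sigma:\mathbb{R}\to[0,1]$ be a link function. Write $\|\cdot\|_{\max}$ for the largest absolute value of an entry and $\|\cdot\|_*$ for the nuclear norm. The propensity score matrix $P$ is given by $P_{u,i}=\sigma(A_{u,i})$. We observe the random matrix $X$ in which, independently over the entries, $X_{u,i}=X^*_{u,i}$ with probability $P_{u,i}$ and $X_{u,i}=\star$ (missing) otherwise; let $\Omega=\{(u,i):X_{u,i}\neq\star\}$ and $M_{u,i}=\mathbf{1}\{X_{u,i}\ne\star\}$. Assume that for constants $\theta,\alpha,\phi\in(0,\infty)$: (A1) $\|A\|_*\le\theta\sqrt{mn}$; (A2) $\|A\|_{\max}\le\alpha$; (A3) $\|X^*\|_{\max}\le\phi$. Let $\tau\ge\theta$ and $\gamma\ge\alpha$. Suppose that $\sigma$ is differentiable, that $0<\sigma(x)<1$ for $x\in[-\gamma,\gamma]$, and that $$L_\gamma:=\sup_{x\in[-\gamma,\gamma]}\frac{|\sigma'(x)|}{\sigma(x)(1-\sigma(x))}$$ is finite. The algorithm 1bitMC returns $\widehat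 P_{u,i}=\sigma(\widehat A_{u,i})$, where $\widehat A$ is any maximizer of $$\sum_{u=1}^m\sum_{i=1}^n\big[M_{u,i}\log\sigma(\Gamma_{u,i})+(1-M_{u,i})\log(1-\sigma(\Gamma_{u,i}))\big]$$ over all $\Gamma\in\mathbb{R}^{m\times n}$ with $\|\Gamma\|_*\le\tau\sqrt{mn}$ and $\|\Gamma\|_{\max}\le\gamma$. Let $\widehat S\in\mathbb{R}^{m\times n}$ be any fixed (non-random) matrix with $\|\widehat S\|_{\max}\le\psi$, where $\psi\ge\phi$, let $\delta\in(0,1)$, and put $$L_{\text{full MSE}}(\widehat S)=\frac1{mn}\sum_{u=1}^m\sum_{i=1}^n(\widehat S_{u,i}-X^*_{u,i})^2,\qquad L_{\text{IPS-MSE}}(\widehat S|\widehat P)=\frac1{mn}\sum_{(u,i)\in\Omega}\frac{(\widehat S_{u,i}-X_{u,i})^2}{\widehat P_{u,i}}.$$ There is a universal constant $C>0$ (independent of all the quantities above) such that, provided that $m+n\ge C$, with probability at least $1-\frac{C}{m+n}-\delta$ over the randomness in which entries are revealed in $X$, we have $$\frac1{mn}\sum_{u=1}^m\sum_{i=1}^n(\widehat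 P_{u,i}-P_{u,i})^2\le 4eL_\gamma\tau\Big(\frac1{\sqrt m}+\frac1{\sqrt n}\Big)$$ and simultaneously, if $\sigma(-\gamma)=\min_{[-\gamma,\gamma]}\sigma$ and $\sigma(-\alpha)=\min_{[-\alpha,\alpha]}\sigma$ (for instance if $\sigma$ is nondecreasing), $$\big|L_{\text{IPS-MSE}}(\widehat S|\widehat P)-L_{\text{full MSE}}(\widehat S)\big|\le\frac{8\psi^2\sqrt{eL_\gamma\tau}}{\sigma(-\gamma)\sigma(-\alpha)}\Big(\frac1{m^{1/4}}+\frac1{n^{1/4}}\Big)+\frac{4\psi^2}{\sigma(-\alpha)}\sqrt{\frac1{2mn}\log\frac2\delta}.$$ Moreover, the standard logistic function $\sigma(x)=1/(1+e^{-x})$ satisfies the assumptions on $\sigma$ with $L_\gamma=1$ for every $\gamma>0$. -/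

import Mathlib

open MeasureTheory ProbabilityTheory

namespace OneBitMC

/-! ### Matrix norms -/

/-- Entrywise maximum norm `max_{u,i} |A u i|`. -/
noncomputable def maxNorm {m n : ℕ} (A : Matrix (Fin m) (Fin n) ℝ) : ℝ :=
  ⨆ p : Fin m × Fin n, |A p.1 p.2|

/-- Nuclear norm: the sum of the singular values (an `m × n` matrix, as a map from `ℝⁿ` to `ℝᵐ`,
has the `n` singular values with indices `0, …, n - 1`, zeros included). -/
noncomputable def nuclearNorm {m n : ℕ} (A : Matrix (Fin m) (Fin n) ℝ) : ℝ :=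
  ∑ k : Fin n, (Matrix.toEuclideanLin A).singularValues k

/-! ### Link functions -/

/-- `L_γ`, the supremum of `|σ'(x)| / (σ(x) (1 - σ(x)))` over `x ∈ [-γ, γ]`. -/
noncomputable def linkConst (σ : ℝ → ℝ) (γ : ℝ) : ℝ :=
  sSup ((fun x => |deriv σ x| / (σ x * (1 - σ x))) '' Set.Icc (-γ) γ)

/-- `σ : ℝ → [0,1]` is differentiable, and `L_γ` exists (its denominators do not vanish) and is
finite. -/
structure AdmissibleLink (σ : ℝ → ℝ) (γ : ℝ) : Prop where
  mem_Icc : ∀ x, σ x ∈ Set.Icc (0 : ℝ) 1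
  differentiable : Differentiable ℝ σ
  mem_Ioo : ∀ x ∈ Set.Icc (-γ) γ, σ x ∈ Set.Ioo (0 : ℝ) 1
  bddAbove : BddAbove ((fun x => |deriv σ x| / (σ x * (1 - σ x))) '' Set.Icc (-γ) γ)

/-! ### Partially observed matrices; `none` stands for a missing entry `⋆` -/

/-- The random matrix `X` reveals each entry of `Xstar` with probability `P u i`, independently
over the entries; the entries that are not revealed are missing. -/
structure RevealsIndependently {m n : ℕ} {𝓞 : Type*} [MeasurableSpace 𝓞] (μ : Measure 𝓞)
    (Xstar P : Matrix (Fin m) (Fin n) ℝ) (X : 𝓞 → Matrix (Fin m) (Fin n) (Option ℝ)) : Prop where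
  eq_none_or : ∀ ω u i, X ω u i = none ∨ X ω u i = some (Xstar u i)
  measurableSet : ∀ u i, MeasurableSet {ω | X ω u i ≠ none}
  prob : ∀ u i, μ.real {ω | X ω u i ≠ none} = P u i
  indep : iIndepSet (fun p : Fin m × Fin n => {ω | X ω p.1 p.2 ≠ none}) μ

/-- The set `Ω` of revealed positions. -/
def revealed {m n : ℕ} (X : Matrix (Fin m) (Fin n) (Option ℝ)) : Finset (Fin m × Fin n) :=
  {p | (X p.1 p.2).isSome}

/-- The missingness mask `M ∈ {0,1}^{m×n}`, with `M u i = 1` iff the entry is revealed. -/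
def mask {m n : ℕ} (X : Matrix (Fin m) (Fin n) (Option ℝ)) : Matrix (Fin m) (Fin n) ℝ :=
  fun u i => if (X u i).isSome then 1 else 0

/-! ### The estimator `1bitMC` -/

/-- The feasible set `F_{τ,γ}`. -/
def feasible (m n : ℕ) (τ γ : ℝ) : Set (Matrix (Fin m) (Fin n) ℝ) :=
  {Γ | nuclearNorm Γ ≤ τ * √((m : ℝ) * n) ∧ maxNorm Γ ≤ γ}

/-- The Bernoulli log-likelihood of the mask `M` at the parameter matrix `Γ`. -/
noncomputable def logLik {m n : ℕ} (σ : ℝ → ℝ) (M Γ : Matrix (Fin m) (Fin n) ℝ) : ℝ :=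
  ∑ u, ∑ i, (M u i * Real.log (σ (Γ u i)) + (1 - M u i) * Real.log (1 - σ (Γ u i)))

/-- `Phat` is an output of `1bitMC` on the mask `M`: it is `σ` applied entrywise to some maximizer
of the log-likelihood over the feasible set. -/
def IsOutput {m n : ℕ} (σ : ℝ → ℝ) (τ γ : ℝ) (M Phat : Matrix (Fin m) (Fin n) ℝ) : Prop :=
  ∃ Ahat ∈ feasible m n τ γ, IsMaxOn (logLik σ M) (feasible m n τ γ) Ahat ∧ Phat = Ahat.map σ

/-! ### Losses -/

/-- The fully observed mean squared error. -/
noncomputable def fullMSE {m n : ℕ} (Xstar Shat : Matrix (Fin m) (Fin n) ℝ) : ℝ :=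
  1 / ((m : ℝ) * n) * ∑ u, ∑ i, (Shat u i - Xstar u i) ^ 2

/-- The inverse-propensity-scored mean squared error for the partially observed matrix `X` and
propensity scores `P` (the default value of `getD` is never used: the sum is over revealed
positions). -/
noncomputable def ipsMSE {m n : ℕ} (X : Matrix (Fin m) (Fin n) (Option ℝ))
    (Shat P : Matrix (Fin m) (Fin n) ℝ) : ℝ :=
  1 / ((m : ℝ) * n) *
    ∑ p ∈ revealed X, (Shat p.1 p.2 - (X p.1 p.2).getD 0) ^ 2 / P p.1 p.2

end OneBitMC

/-! Write `g` for the log-odds of the link. The log-likelihood at `Γ` minus that at the true `A` is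
a term linear in the centred mask, with coefficients `g(Γ) - g(A)`, minus a sum of Bernoulli KL
divergences (`logLik_sub_logLik`). At a maximizer this difference is nonnegative, so by Pinsker's
inequality twice the squared error of the propensities is at most the linear term. It remains to
bound that term uniformly over the feasible set.

On `[-γ, γ]` the function `g` is `L_γ`-Lipschitz. Exponential moments of the supremum of the linear
term are therefore dominated by those of a Rademacher process with coefficients `L_γ (Γ - A)`
(`bernoulli_le_rademacher`: centring by convexity, then contraction, one coordinate at a time).
Duality of the nuclear and operator norms reduces this process to the operator norm of a random sign
matrix, which half-nets of the two unit balls control (`sum_exp_iSup_nuclearNorm_le`). A Chernoff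
bound gives `maskWeight_deviation_le`.

For the loss, the IPS estimate with the true propensities is unbiased and concentrates by
Hoeffding's inequality. Replacing them by the estimated ones costs, deterministically, a multiple of
the root mean squared error already bounded (`abs_ipsMSE_sub_le`). A union bound over the two bad
events finishes. -/

namespace OneBitMC

/-! ### Comparison of Bernoulli and Rademacher processes -/

/-- Weak majorization for the increasing convex function `exp`. When `J < V`, the difference of the
two sides is at least `(exp I - exp V) * (1 - exp (J - V))`, a product of nonnegative factors. -/
lemma exp_add_exp_le_of_le_left {U V I J : ℝ} (hsum : U + V ≤ I + J) (hU : U ≤ I) (hV : V ≤ I) :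
    Real.exp U + Real.exp V ≤ Real.exp I + Real.exp J := by
  rcases le_or_gt V J with h | h
  · exact add_le_add (Real.exp_le_exp.2 hU) (Real.exp_le_exp.2 h)
  · have h1 : Real.exp U ≤ Real.exp (I + (J - V)) := Real.exp_le_exp.2 (by linarith)
    have h2 : Real.exp J = Real.exp V * Real.exp (J - V) := by rw [← Real.exp_add]; congr 1; ring
    rw [Real.exp_add] at h1
    have h3 : Real.exp V ≤ Real.exp I := Real.exp_le_exp.2 hV
    have h4 : Real.exp (J - V) ≤ 1 := Real.exp_le_one_iff.2 (by linarith)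
    nlinarith

lemma exp_add_exp_le {U V I J : ℝ} (hsum : U + V ≤ I + J) (hU : U ≤ max I J) (hV : V ≤ max I J) :
    Real.exp U + Real.exp V ≤ Real.exp I + Real.exp J := by
  rcases le_total J I with h | h
  · rw [max_eq_left h] at hU hV
    exact exp_add_exp_le_of_le_left hsum hU hV
  · rw [max_eq_right h] at hU hV
    rw [add_comm (Real.exp I)]
    exact exp_add_exp_le_of_le_left (by linarith) hU hV

section Comparison

variable {T : Type*} [Finite T] [Nonempty T]

/-- Contraction: a symmetric sign does not see a contraction fixing `0`. -/
lemma exp_iSup_contraction (a x y : T → ℝ) (hy : ∀ t, |y t| ≤ |x t|)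
    (hxy : ∀ s t, |y s - y t| ≤ |x s - x t|) :
    Real.exp (⨆ t, (a t + y t)) + Real.exp (⨆ t, (a t - y t)) ≤
      Real.exp (⨆ t, (a t + x t)) + Real.exp (⨆ t, (a t - x t)) := by
  obtain ⟨t, ht⟩ := exists_eq_ciSup_of_finite (f := fun t => a t + y t)
  obtain ⟨s, hs⟩ := exists_eq_ciSup_of_finite (f := fun t => a t - y t)
  have hI : ∀ r, a r + x r ≤ ⨆ t, (a t + x t) :=
    fun r => le_ciSup (f := fun t => a t + x t) (Set.finite_range _).bddAbove r
  have hJ : ∀ r, a r - x r ≤ ⨆ t, (a t - x t) :=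
    fun r => le_ciSup (f := fun t => a t - x t) (Set.finite_range _).bddAbove r
  -- Since `|y| ≤ |x|`, this bounds both suprema on the left by the larger one on the right; the sum
  -- condition comes from the contraction at the two optimal indices.
  have key : ∀ r, a r + |x r| ≤ max (⨆ t, (a t + x t)) (⨆ t, (a t - x t)) := fun r => by
    rcases abs_cases (x r) with h | h <;> rw [h.1]
    · exact (hI r).trans (le_max_left _ _)
    · exact le_trans (by linarith [hJ r]) (le_max_right _ _)
  rw [← ht, ← hs]
  apply exp_add_exp_le
  · have h1 := le_abs_self (y t - y s)
    have h2 := hxy t s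
    have hIt := hI t
    have hIs := hI s
    have hJt := hJ t
    have hJs := hJ s
    rcases abs_cases (x t - x s) with h | h <;> linarith
  · have := le_abs_self (y t)
    linarith [key t, hy t]
  · have := neg_abs_le (y s)
    linarith [key s, hy s]

/-- A supremum of affine functions of `c` is convex in `c`, and `exp` is increasing and convex; `c`
is the average of `1` and `-1` with weights `(1 + c) / 2` and `(1 - c) / 2`. -/
lemma exp_iSup_convex (a y : T → ℝ) {c : ℝ} (hc : c ∈ Set.Icc (-1 : ℝ) 1) :
    Real.exp (⨆ t, (a t + c * y t)) ≤
      (1 + c) / 2 * Real.exp (⨆ t, (a t + y t)) + (1 - c) / 2 * Real.exp (⨆ t, (a t - y t)) := by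
  have h1 : 0 ≤ (1 + c) / 2 := by linarith [hc.1]
  have h2 : 0 ≤ (1 - c) / 2 := by linarith [hc.2]
  have h3 := convexOn_exp.2 (Set.mem_univ (⨆ t, (a t + y t))) (Set.mem_univ (⨆ t, (a t - y t)))
    h1 h2 (by ring)
  simp only [smul_eq_mul] at h3
  refine le_trans (Real.exp_le_exp.2 (ciSup_le fun t => ?_)) h3
  have hI := le_ciSup (f := fun t => a t + y t) (Set.finite_range _).bddAbove t
  have hJ := le_ciSup (f := fun t => a t - y t) (Set.finite_range _).bddAbove t
  have := mul_le_mul_of_nonneg_left hI h1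
  have := mul_le_mul_of_nonneg_left hJ h2
  linarith

/-- The centred Bernoulli variable takes values in `[-1, 1]` and has mean zero, so averaging the
convexity bound over it leaves equal weights on the signs `±1`. Contraction then turns `y` into `x`,
and no symmetrization factor `2` is lost. -/
lemma bernoulli_step (a x y : T → ℝ) (hy : ∀ t, |y t| ≤ |x t|)
    (hxy : ∀ s t, |y s - y t| ≤ |x s - x t|) {p : ℝ} (hp : p ∈ Set.Icc (0 : ℝ) 1) :
    p * Real.exp (⨆ t, (a t + (1 - p) * y t)) + (1 - p) * Real.exp (⨆ t, (a t + (0 - p) * y t)) ≤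
      1 / 2 * Real.exp (⨆ t, (a t + 1 * x t)) + 1 / 2 * Real.exp (⨆ t, (a t + (-1) * x t)) := by
  have h1 := exp_iSup_convex a y (c := 1 - p) ⟨by linarith [hp.2], by linarith [hp.1]⟩
  have h2 := exp_iSup_convex a y (c := 0 - p) ⟨by linarith [hp.2], by linarith [hp.1]⟩
  have h3 := exp_iSup_contraction a x y hy hxy
  have h4 := mul_le_mul_of_nonneg_left h1 hp.1
  have h5 := mul_le_mul_of_nonneg_left h2 (sub_nonneg.2 hp.2)
  simp only [one_mul, neg_one_mul, ← sub_eq_add_neg]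
  nlinarith

/-- Exponential moments of the supremum of a centred Bernoulli process are dominated by those of a
Rademacher process, with coefficients contracted coordinatewise. -/
theorem bernoulli_le_rademacher {ι : Type*} [DecidableEq ι] (s : Finset ι) (p : ι → ℝ)
    (hp : ∀ k, p k ∈ Set.Icc (0 : ℝ) 1) (x y : ι → T → ℝ) (hy : ∀ k t, |y k t| ≤ |x k t|)
    (hxy : ∀ k s t, |y k s - y k t| ≤ |x k s - x k t|) (a : T → ℝ) :
    ∑ R ∈ s.powerset, (∏ k ∈ s, if k ∈ R then p k else 1 - p k) *
        Real.exp (⨆ t, (a t + ∑ k ∈ s, ((if k ∈ R then 1 else 0) - p k) * y k t)) ≤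
      ∑ R ∈ s.powerset, (1 / 2 : ℝ) ^ s.card *
        Real.exp (⨆ t, (a t + ∑ k ∈ s, (if k ∈ R then 1 else -1) * x k t)) := by
  induction s using Finset.induction_on generalizing a with
  | empty => simp
  | insert k s hk ih =>
    rw [Finset.sum_powerset_insert hk, Finset.sum_powerset_insert hk, ← Finset.sum_add_distrib,
      ← Finset.sum_add_distrib]
    have hmem : ∀ R ∈ s.powerset, k ∉ R := fun R hR h => hk (Finset.mem_powerset.1 hR h)
    have hins : ∀ R : Finset ι, ∀ j ∈ s, (j ∈ insert k R ↔ j ∈ R) := fun R j hj => by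
      have : j ≠ k := fun h => hk (h ▸ hj)
      simp [this]
    calc _ = ∑ R ∈ s.powerset, (∏ k ∈ s, if k ∈ R then p k else 1 - p k) *
          (p k * Real.exp (⨆ t, ((a t + ∑ k ∈ s, ((if k ∈ R then 1 else 0) - p k) * y k t) +
            (1 - p k) * y k t)) +
          (1 - p k) * Real.exp (⨆ t, ((a t + ∑ k ∈ s, ((if k ∈ R then 1 else 0) - p k) * y k t) +
            (0 - p k) * y k t))) := by
          refine Finset.sum_congr rfl fun R hR => ?_
          have h1 : ∏ j ∈ s, (if j ∈ insert k R then p j else 1 - p j) =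
              ∏ j ∈ s, if j ∈ R then p j else 1 - p j :=
            Finset.prod_congr rfl fun j hj => by simp only [hins R j hj]
          have h2 : ∀ t, ∑ j ∈ s, ((if j ∈ insert k R then 1 else 0) - p j) * y j t =
              ∑ j ∈ s, ((if j ∈ R then 1 else 0) - p j) * y j t := fun t =>
            Finset.sum_congr rfl fun j hj => by simp only [hins R j hj]
          simp only [Finset.prod_insert hk, Finset.sum_insert hk, h1, h2, hmem R hR,
            Finset.mem_insert_self, if_true, if_false]
          have e1 : ∀ c : ℝ, ∀ f : T → ℝ, (⨆ t, (a t + (c * y k t + f t))) =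
              ⨆ t, (a t + f t + c * y k t) := fun c f => by
            congr 1; ext t; ring
          rw [e1, e1]
          ring
      _ ≤ ∑ R ∈ s.powerset, (∏ k ∈ s, if k ∈ R then p k else 1 - p k) *
          (1 / 2 * Real.exp (⨆ t, ((a t + ∑ k ∈ s, ((if k ∈ R then 1 else 0) - p k) * y k t) +
            1 * x k t)) +
          1 / 2 * Real.exp (⨆ t, ((a t + ∑ k ∈ s, ((if k ∈ R then 1 else 0) - p k) * y k t) +
            (-1) * x k t))) := by
          refine Finset.sum_le_sum fun R _ => mul_le_mul_of_nonneg_left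
            (bernoulli_step _ _ _ (hy k) (hxy k) (hp k)) (Finset.prod_nonneg fun j _ => ?_)
          split_ifs
          · exact (hp j).1
          · exact sub_nonneg.2 (hp j).2
      _ = 1 / 2 * (∑ R ∈ s.powerset, (∏ k ∈ s, if k ∈ R then p k else 1 - p k) *
            Real.exp (⨆ t, ((a t + 1 * x k t) +
              ∑ k ∈ s, ((if k ∈ R then 1 else 0) - p k) * y k t))) +
          1 / 2 * (∑ R ∈ s.powerset, (∏ k ∈ s, if k ∈ R then p k else 1 - p k) *
            Real.exp (⨆ t, ((a t + (-1) * x k t) +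
              ∑ k ∈ s, ((if k ∈ R then 1 else 0) - p k) * y k t))) := by
          rw [Finset.mul_sum, Finset.mul_sum, ← Finset.sum_add_distrib]
          refine Finset.sum_congr rfl fun R _ => ?_
          simp only [add_right_comm (a _) _ (_ * x k _)]
          ring
      _ ≤ 1 / 2 * (∑ R ∈ s.powerset, (1 / 2 : ℝ) ^ s.card * Real.exp (⨆ t, ((a t + 1 * x k t) +
              ∑ k ∈ s, (if k ∈ R then 1 else -1) * x k t))) +
          1 / 2 * (∑ R ∈ s.powerset, (1 / 2 : ℝ) ^ s.card * Real.exp (⨆ t, ((a t + (-1) * x k t) +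
              ∑ k ∈ s, (if k ∈ R then 1 else -1) * x k t))) := by
          -- The new Rademacher term is absorbed into the drift `a`, which is why the induction
          -- generalizes over it.
          exact add_le_add (mul_le_mul_of_nonneg_left (ih fun t => a t + 1 * x k t) (by norm_num))
            (mul_le_mul_of_nonneg_left (ih fun t => a t + (-1) * x k t) (by norm_num))
      _ = _ := by
          rw [Finset.mul_sum, Finset.mul_sum, ← Finset.sum_add_distrib]
          refine Finset.sum_congr rfl fun R hR => ?_
          have h2 : ∀ t, ∑ j ∈ s, (if j ∈ insert k R then (1 : ℝ) else -1) * x j t =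
              ∑ j ∈ s, (if j ∈ R then (1 : ℝ) else -1) * x j t := fun t =>
            Finset.sum_congr rfl fun j hj => by simp only [hins R j hj]
          simp only [Finset.sum_insert hk, h2, hmem R hR, Finset.mem_insert_self, if_true,
            if_false, Finset.card_insert_of_notMem hk, ← add_assoc, pow_succ]
          ring

end Comparison

/-! ### Half-nets of the Euclidean unit ball -/

section Net

variable {E : Type*} [NormedAddCommGroup E] [InnerProductSpace ℝ E]

/-- A `1/2`-separated subset of the unit ball of greatest cardinality is a net, since a point far
from all of it could be added. -/
lemma exists_half_net (E : Type*) [NormedAddCommGroup E] [InnerProductSpace ℝ E]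
    [FiniteDimensional ℝ E] :
    ∃ N : Finset E, N.card ≤ 5 ^ Module.finrank ℝ E ∧ (∀ c ∈ N, ‖c‖ ≤ 1) ∧
      ∀ x : E, ‖x‖ ≤ 1 → ∃ c ∈ N, ‖x - c‖ ≤ 1 / 2 := by
  classical
  let Q : Finset E → Prop := fun s =>
    (∀ c ∈ s, ‖c‖ ≤ 1) ∧ ∀ c ∈ s, ∀ d ∈ s, c ≠ d → 1 / 2 ≤ ‖c - d‖
  have hcard : ∀ s, Q s → s.card ≤ 5 ^ Module.finrank ℝ E := fun s hs => by
    -- Doubling gives `1`-separated points of norm at most `2`, the normalization of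
    -- `Besicovitch.card_le_of_separated`.
    have hinj : Function.Injective fun c : E => (2 : ℝ) • c := smul_right_injective E two_ne_zero
    rw [← Finset.card_image_of_injective s hinj]
    refine Besicovitch.card_le_of_separated _ ?_ ?_
    · simp only [Finset.mem_image, forall_exists_index, and_imp, forall_apply_eq_imp_iff₂]
      intro c hc
      rw [norm_smul, Real.norm_two]
      linarith [hs.1 c hc]
    · simp only [Finset.mem_image, forall_exists_index, and_imp, forall_apply_eq_imp_iff₂]
      intro c hc d hd hcd
      rw [← smul_sub, norm_smul, Real.norm_two]
      linarith [hs.2 c hc d hd fun h => hcd (by rw [h])]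
  have hex : ∃ k, ∃ s, Q s ∧ s.card = k := ⟨0, ∅, by simp [Q], rfl⟩
  have hb : ∀ k, (∃ s, Q s ∧ s.card = k) → k ≤ 5 ^ Module.finrank ℝ E := by
    rintro k ⟨s, hs, rfl⟩
    exact hcard s hs
  obtain ⟨s, hs, hsk⟩ := Nat.findGreatest_spec (P := fun k => ∃ s, Q s ∧ s.card = k)
    (hb _ hex.choose_spec) hex.choose_spec
  refine ⟨s, hcard s hs, hs.1, fun x hx => ?_⟩
  by_contra! hcon
  have hxs : x ∉ s := fun h => by
    have := hcon x h
    norm_num at this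
  have hQ : Q (insert x s) := by
    refine ⟨?_, ?_⟩
    · intro c hc
      rcases Finset.mem_insert.1 hc with rfl | hc
      · exact hx
      · exact hs.1 c hc
    · intro c hc d hd hcd
      rcases Finset.mem_insert.1 hc with hc | hc <;> rcases Finset.mem_insert.1 hd with hd | hd
      · exact absurd (hc.trans hd.symm) hcd
      · rw [hc]; exact (hcon d hd).le
      · rw [hd, norm_sub_rev]; exact (hcon c hc).le
      · exact hs.2 c hc d hd hcd
  have := Nat.le_findGreatest (P := fun k => ∃ s, Q s ∧ s.card = k) (hcard _ hQ) ⟨_, hQ, rfl⟩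
  rw [Finset.card_insert_of_notMem hxs] at this
  omega

/-- Testing against the unit vector along `w` and moving to a net point loses at most `‖w‖ / 2`,
which is absorbed on the left. -/
lemma norm_le_two_mul_of_net {N : Finset E} (hN : ∀ x : E, ‖x‖ ≤ 1 → ∃ c ∈ N, ‖x - c‖ ≤ 1 / 2)
    {w : E} {B : ℝ} (hB : ∀ c ∈ N, inner ℝ c w ≤ B) : ‖w‖ ≤ 2 * B := by
  have hx : ‖‖w‖⁻¹ • w‖ ≤ 1 := by
    rw [norm_smul, norm_inv, norm_norm]
    exact inv_mul_le_one
  have hxw : inner ℝ (‖w‖⁻¹ • w) w = ‖w‖ := by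
    rw [real_inner_smul_left, real_inner_self_eq_norm_sq]
    rcases eq_or_ne ‖w‖ 0 with h | h
    · simp [h]
    · field_simp
  obtain ⟨c, hc, hxc⟩ := hN _ hx
  have h1 := real_inner_le_norm (‖w‖⁻¹ • w - c) w
  rw [inner_sub_left, hxw] at h1
  nlinarith [hB c hc, norm_nonneg w]

lemma opNorm_le_two_mul_of_net {F : Type*} [NormedAddCommGroup F] [InnerProductSpace ℝ F]
    {N : Finset E} (hN : ∀ x : E, ‖x‖ ≤ 1 → ∃ c ∈ N, ‖x - c‖ ≤ 1 / 2)
    (f : E →L[ℝ] F) {B : ℝ} (hB : ∀ c ∈ N, ‖f c‖ ≤ B) : ‖f‖ ≤ 2 * B := by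
  obtain ⟨c, hc, -⟩ := hN 0 (by simp)
  have hB0 : 0 ≤ B := (norm_nonneg _).trans (hB c hc)
  have : ‖f‖ ≤ B + ‖f‖ / 2 := by
    refine f.opNorm_le_of_unit_norm (by positivity) fun x hx => ?_
    obtain ⟨c, hc, hxc⟩ := hN x hx.le
    calc ‖f x‖ = ‖f c + f (x - c)‖ := by simp
      _ ≤ ‖f c‖ + ‖f (x - c)‖ := norm_add_le _ _
      _ ≤ B + ‖f‖ * (1 / 2) := add_le_add (hB c hc)
          ((f.le_opNorm _).trans (mul_le_mul_of_nonneg_left hxc (norm_nonneg _)))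
      _ = _ := by ring
  linarith

end Net

/-! ### Duality between the operator norm and the nuclear norm -/

/-- The left side is the trace of `H* G`. In an orthonormal eigenbasis `b` of `G* G` it equals `∑ ⟪H
b k, G b k⟫`, and `‖G (b k)‖` is the `k`-th singular value of `G`. -/
lemma sum_mul_le_nuclearNorm {m n : ℕ} (D Γ : Matrix (Fin m) (Fin n) ℝ) {B : ℝ}
    (hB : ∀ x, ‖Matrix.toEuclideanLin D x‖ ≤ B * ‖x‖) :
    ∑ u, ∑ i, D u i * Γ u i ≤ B * nuclearNorm Γ := by
  set G := Matrix.toEuclideanLin Γ with hG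
  set H := Matrix.toEuclideanLin D with hH
  have hn : Module.finrank ℝ (EuclideanSpace ℝ (Fin n)) = n := by simp
  set b := G.isSymmetric_adjoint_comp_self.eigenvectorBasis hn with hb
  have hGb : ∀ k, ‖G (b k)‖ = G.singularValues k := fun k => by
    rw [← sq_eq_sq₀ (norm_nonneg _) (G.singularValues_nonneg k), G.sq_singularValues_fin hn,
      ← real_inner_self_eq_norm_sq, ← LinearMap.adjoint_inner_right, ← LinearMap.comp_apply,
      G.isSymmetric_adjoint_comp_self.apply_eigenvectorBasis hn k]
    simp [← hb, inner_smul_right]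
  have htr : ∑ u, ∑ i, D u i * Γ u i = ∑ k, inner ℝ (H (b k)) (G (b k)) := by
    have h1 := LinearMap.trace_eq_sum_inner (LinearMap.adjoint H ∘ₗ G) b
    have h2 := LinearMap.trace_eq_sum_inner (LinearMap.adjoint H ∘ₗ G)
      (EuclideanSpace.basisFun (Fin n) ℝ)
    simp only [LinearMap.comp_apply, LinearMap.adjoint_inner_right] at h1 h2
    rw [← h1, h2, Finset.sum_comm]
    refine Finset.sum_congr rfl fun i _ => ?_
    simp [H, G, PiLp.inner_apply, Matrix.toLpLin_apply, mul_comm]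
  rw [htr, nuclearNorm, Finset.mul_sum]
  refine Finset.sum_le_sum fun k _ => ?_
  calc inner ℝ (H (b k)) (G (b k)) ≤ ‖H (b k)‖ * ‖G (b k)‖ := real_inner_le_norm _ _
    _ ≤ (B * ‖b k‖) * ‖G (b k)‖ := mul_le_mul_of_nonneg_right (hB _) (norm_nonneg _)
    _ = B * G.singularValues k := by rw [hGb, b.orthonormal.1 k, mul_one]

/-! ### Exponential moments of the operator norm of a Rademacher matrix -/

/-- The sign matrix that is `1` on `R` and `-1` off `R`. -/
def signMatrix {m n : ℕ} (R : Finset (Fin m × Fin n)) : Matrix (Fin m) (Fin n) ℝ :=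
  fun u i => if (u, i) ∈ R then 1 else -1

/-- By independence of the signs the average factors into `∏ cosh (κ x_u y_i)`; `cosh z ≤ exp (z ^ 2
/ 2)`, and the squares sum to `κ ^ 2 ‖x‖ ^ 2 ‖y‖ ^ 2`. -/
lemma sum_exp_bilinear_le {m n : ℕ} (κ : ℝ) (x : EuclideanSpace ℝ (Fin m))
    (y : EuclideanSpace ℝ (Fin n)) (hx : ‖x‖ ≤ 1) (hy : ‖y‖ ≤ 1) :
    ∑ R : Finset (Fin m × Fin n), (1 / 2 : ℝ) ^ (m * n) *
      Real.exp (κ * inner ℝ x (Matrix.toEuclideanLin (signMatrix R) y)) ≤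
        Real.exp (κ ^ 2 / 2) := by
  classical
  have h1 : ∀ R : Finset (Fin m × Fin n),
      κ * inner ℝ x (Matrix.toEuclideanLin (signMatrix R) y) =
        ∑ p : Fin m × Fin n, (if p ∈ R then κ * (x p.1 * y p.2) else -(κ * (x p.1 * y p.2))) := by
    intro R
    rw [Fintype.sum_prod_type]
    simp only [PiLp.inner_apply, Matrix.toLpLin_apply, Matrix.mulVec, dotProduct, signMatrix,
      Finset.mul_sum, RCLike.inner_apply, conj_trivial, Finset.sum_mul]
    refine Finset.sum_congr rfl fun u _ => Finset.sum_congr rfl fun i _ => ?_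
    split_ifs <;> ring
  have h2 : ∀ R : Finset (Fin m × Fin n),
      (1 / 2 : ℝ) ^ (m * n) *
        Real.exp (κ * inner ℝ x (Matrix.toEuclideanLin (signMatrix R) y)) =
      (∏ p ∈ R, (Real.exp (κ * (x p.1 * y p.2)) / 2)) *
        ∏ p ∈ Finset.univ \ R, (Real.exp (-(κ * (x p.1 * y p.2))) / 2) := by
    intro R
    rw [h1, Real.exp_sum]
    have : (1 / 2 : ℝ) ^ (m * n) = ∏ p : Fin m × Fin n, (1 / 2 : ℝ) := by simp
    rw [this, ← Finset.prod_mul_distrib, ← Finset.prod_sdiff (Finset.subset_univ R), mul_comm]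
    congr 1
    · refine Finset.prod_congr rfl fun p hp => ?_
      rw [if_pos hp]; ring
    · refine Finset.prod_congr rfl fun p hp => ?_
      rw [if_neg (Finset.mem_sdiff.1 hp).2]; ring
  simp only [h2]
  rw [← Finset.powerset_univ, ← Finset.prod_add]
  have hxx : ∑ u, x u ^ 2 ≤ 1 := by
    have := EuclideanSpace.real_norm_sq_eq x
    rw [← this]; exact pow_le_one₀ (norm_nonneg _) hx
  have hyy : ∑ u, y u ^ 2 ≤ 1 := by
    have := EuclideanSpace.real_norm_sq_eq y
    rw [← this]; exact pow_le_one₀ (norm_nonneg _) hy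
  calc _ ≤ ∏ p : Fin m × Fin n, Real.exp ((κ * (x p.1 * y p.2)) ^ 2 / 2) := by
        refine Finset.prod_le_prod (fun p _ => by positivity) fun p _ => ?_
        refine le_trans (le_of_eq ?_) (Real.cosh_le_exp_half_sq _)
        rw [Real.cosh_eq]; ring
    _ = Real.exp (κ ^ 2 / 2 * ((∑ u, x u ^ 2) * ∑ i, y i ^ 2)) := by
        rw [← Real.exp_sum, Finset.sum_mul_sum, Fintype.sum_prod_type, Finset.mul_sum]
        congr 1
        refine Finset.sum_congr rfl fun u _ => ?_
        rw [Finset.mul_sum]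
        exact Finset.sum_congr rfl fun i _ => by ring
    _ ≤ Real.exp (κ ^ 2 / 2) := by
        refine Real.exp_le_exp.2 (mul_le_of_le_one_right (by positivity) ?_)
        exact mul_le_one₀ hxx (Finset.sum_nonneg fun i _ => sq_nonneg _) hyy

/-- Exponential moments of Rademacher averages over a nuclear norm ball. -/
theorem sum_exp_iSup_nuclearNorm_le {T : Type*} [Nonempty T] {m n : ℕ}
    (Γ : T → Matrix (Fin m) (Fin n) ℝ) {κ r : ℝ} (hκ : 0 ≤ κ)
    (hΓ : ∀ t (D : Matrix (Fin m) (Fin n) ℝ) (B : ℝ), 0 ≤ B →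
      (∀ x, ‖Matrix.toEuclideanLin D x‖ ≤ B * ‖x‖) → ∑ u, ∑ i, D u i * Γ t u i ≤ B * r) :
    ∑ R : Finset (Fin m × Fin n), (1 / 2 : ℝ) ^ (m * n) *
      Real.exp (⨆ t, κ * ∑ u, ∑ i, signMatrix R u i * Γ t u i) ≤
        5 ^ (m + n) * Real.exp (8 * (κ * r) ^ 2) := by
  obtain ⟨M, hMc, hM1, hM⟩ := exists_half_net (EuclideanSpace ℝ (Fin m))
  obtain ⟨N, hNc, hN1, hN⟩ := exists_half_net (EuclideanSpace ℝ (Fin n))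
  simp only [finrank_euclideanSpace, Fintype.card_fin] at hMc hNc
  have hMN : (M ×ˢ N).Nonempty := by
    obtain ⟨c, hc, -⟩ := hM 0 (by simp)
    obtain ⟨d, hd, -⟩ := hN 0 (by simp)
    exact ⟨(c, d), Finset.mk_mem_product hc hd⟩
  have key : ∀ R : Finset (Fin m × Fin n),
      Real.exp (⨆ t, κ * ∑ u, ∑ i, signMatrix R u i * Γ t u i) ≤
        ∑ q ∈ M ×ˢ N,
          Real.exp ((4 * (κ * r)) * inner ℝ q.1 (Matrix.toEuclideanLin (signMatrix R) q.2)) := by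
    intro R
    obtain ⟨q, hq, hmax⟩ := Finset.exists_max_image (M ×ˢ N)
      (fun q => inner ℝ q.1 (Matrix.toEuclideanLin (signMatrix R) q.2)) hMN
    set b := inner ℝ q.1 (Matrix.toEuclideanLin (signMatrix R) q.2) with hb
    have hnet : ∀ d ∈ N, ‖Matrix.toEuclideanLin (signMatrix R) d‖ ≤ 2 * b := fun d hd =>
      norm_le_two_mul_of_net hM fun c hc => hmax (c, d) (Finset.mk_mem_product hc hd)
    -- Each of the two nets costs a factor `2`, hence the `4` in the exponent of `key`.
    have hop := opNorm_le_two_mul_of_net hN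
      (LinearMap.toContinuousLinearMap (Matrix.toEuclideanLin (signMatrix R))) hnet
    have hb0 : 0 ≤ 2 * (2 * b) := (norm_nonneg _).trans hop
    refine le_trans (Real.exp_le_exp.2 (ciSup_le fun t => ?_))
      (Finset.single_le_sum (f := fun q : EuclideanSpace ℝ (Fin m) × EuclideanSpace ℝ (Fin n) =>
        Real.exp ((4 * (κ * r)) * inner ℝ q.1 (Matrix.toEuclideanLin (signMatrix R) q.2)))
        (fun _ _ => (Real.exp_pos _).le) hq)
    rw [← hb]
    have h1 := hΓ t (signMatrix R) (2 * (2 * b)) hb0 fun x =>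
      ((LinearMap.toContinuousLinearMap (Matrix.toEuclideanLin (signMatrix R))).le_opNorm x).trans
        (mul_le_mul_of_nonneg_right hop (norm_nonneg _))
    calc _ ≤ κ * (2 * (2 * b) * r) := mul_le_mul_of_nonneg_left h1 hκ
      _ = _ := by ring
  calc _ ≤ ∑ R : Finset (Fin m × Fin n), (1 / 2 : ℝ) ^ (m * n) * ∑ q ∈ M ×ˢ N,
          Real.exp ((4 * (κ * r)) * inner ℝ q.1 (Matrix.toEuclideanLin (signMatrix R) q.2)) :=
        Finset.sum_le_sum fun R _ => mul_le_mul_of_nonneg_left (key R) (by positivity)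
    _ = ∑ q ∈ M ×ˢ N, ∑ R : Finset (Fin m × Fin n), (1 / 2 : ℝ) ^ (m * n) *
          Real.exp ((4 * (κ * r)) * inner ℝ q.1 (Matrix.toEuclideanLin (signMatrix R) q.2)) := by
        simp only [Finset.mul_sum]
        exact Finset.sum_comm
    _ ≤ ∑ q ∈ M ×ˢ N, Real.exp ((4 * (κ * r)) ^ 2 / 2) := Finset.sum_le_sum fun q hq =>
        sum_exp_bilinear_le _ _ _ (hM1 _ (Finset.mem_product.1 hq).1)
          (hN1 _ (Finset.mem_product.1 hq).2)
    _ = (M.card * N.card : ℝ) * Real.exp (8 * (κ * r) ^ 2) := by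
        rw [Finset.sum_const, Finset.card_product, nsmul_eq_mul]
        push_cast
        ring_nf
    _ ≤ _ := by
        gcongr
        rw [pow_add]
        exact_mod_cast Nat.mul_le_mul hMc hNc

/-! ### The law of the mask -/

/-- The probability that exactly the positions in `R` are revealed. -/
def maskWeight {ι : Type*} [Fintype ι] [DecidableEq ι] (p : ι → ℝ) (R : Finset ι) : ℝ :=
  ∏ k, if k ∈ R then p k else 1 - p k

lemma maskWeight_nonneg {ι : Type*} [Fintype ι] [DecidableEq ι] {p : ι → ℝ}
    (hp : ∀ k, p k ∈ Set.Icc (0 : ℝ) 1) (R : Finset ι) : 0 ≤ maskWeight p R :=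
  Finset.prod_nonneg fun k _ => by
    split_ifs
    · exact (hp k).1
    · exact sub_nonneg.2 (hp k).2

lemma mem_revealed {m n : ℕ} (X : Matrix (Fin m) (Fin n) (Option ℝ)) (k : Fin m × Fin n) :
    k ∈ revealed X ↔ X k.1 k.2 ≠ none := by
  simp [revealed, Option.isSome_iff_ne_none]

lemma mask_eq {m n : ℕ} (X : Matrix (Fin m) (Fin n) (Option ℝ)) (u : Fin m) (i : Fin n) :
    mask X u i = if (u, i) ∈ revealed X then 1 else 0 := by
  simp [mask, revealed]

section Law

variable {m n : ℕ} {𝓞 : Type*} [MeasurableSpace 𝓞] {μ : Measure 𝓞} [IsProbabilityMeasure μ]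
  {Xstar P : Matrix (Fin m) (Fin n) ℝ} {X : 𝓞 → Matrix (Fin m) (Fin n) (Option ℝ)}

lemma RevealsIndependently.prob_mem_Icc (h : RevealsIndependently μ Xstar P X)
    (k : Fin m × Fin n) : P k.1 k.2 ∈ Set.Icc (0 : ℝ) 1 := by
  rw [← h.prob]
  exact ⟨measureReal_nonneg, measureReal_le_one⟩

lemma RevealsIndependently.measureReal_revealed_eq (h : RevealsIndependently μ Xstar P X)
    (R : Finset (Fin m × Fin n)) :
    μ.real {ω | revealed (X ω) = R} = maskWeight (fun k => P k.1 k.2) R := by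
  have hset : {ω | revealed (X ω) = R} = ⋂ k ∈ (Finset.univ : Finset (Fin m × Fin n)),
      if k ∈ R then {ω | X ω k.1 k.2 ≠ none} else {ω | X ω k.1 k.2 ≠ none}ᶜ := by
    ext ω
    simp only [Set.mem_ofPred_eq, Finset.mem_univ, Set.iInter_true, Set.mem_iInter,
      Finset.ext_iff, mem_revealed]
    refine forall_congr' fun k => ?_
    split_ifs with hk <;> simp [hk]
  have hgen : ∀ k : Fin m × Fin n, MeasurableSet[MeasurableSpace.generateFrom
      {{ω | X ω k.1 k.2 ≠ none}}] {ω | X ω k.1 k.2 ≠ none} := fun k =>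
    MeasurableSpace.measurableSet_generateFrom rfl
  rw [hset, measureReal_def, (iIndepSet_iff _ _).1 h.indep Finset.univ, ENNReal.toReal_prod,
    maskWeight]
  · refine Finset.prod_congr rfl fun k _ => ?_
    split_ifs
    · exact h.prob _ _
    · rw [← measureReal_def, probReal_compl_eq_one_sub (h.measurableSet _ _), h.prob]
  · intro k _
    split_ifs
    · exact hgen k
    · exact (hgen k).compl

/-- The mask takes finitely many values, so tail bounds become finite sums; subadditivity suffices.
-/
lemma RevealsIndependently.measureReal_le_sum (h : RevealsIndependently μ Xstar P X)
    (Q : Finset (Fin m × Fin n) → Prop) [DecidablePred Q] :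
    μ.real {ω | Q (revealed (X ω))} ≤
      ∑ R with Q R, maskWeight (fun k => P k.1 k.2) R := by
  have hsub : {ω | Q (revealed (X ω))} ⊆
      ⋃ R ∈ Finset.univ.filter Q, {ω | revealed (X ω) = R} := fun ω hω => by
    simpa using hω
  refine (measureReal_mono hsub (measure_ne_top _ _)).trans
    ((measureReal_biUnion_finset_le _ _).trans ?_)
  exact Finset.sum_le_sum fun R _ => (h.measureReal_revealed_eq R).le

end Law

/-! ### Uniform deviation of the log-likelihood -/

/-- Chernoff bound for the uniform deviation. Choosing one matrix `G R` in `𝓕` per mask `R`, a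
violating one when `Q R` holds, replaces the supremum over `𝓕` by one over a finite family. -/
theorem maskWeight_deviation_le {m n : ℕ} (p : Fin m × Fin n → ℝ)
    (hp : ∀ k, p k ∈ Set.Icc (0 : ℝ) 1) (𝓕 : Set (Matrix (Fin m) (Fin n) ℝ))
    (A : Matrix (Fin m) (Fin n) ℝ) (hA : A ∈ 𝓕) {r γ L t : ℝ} (hr : 0 < r) (hL : 0 ≤ L)
    (ht : 0 ≤ t) (g : ℝ → ℝ) (hnuc : ∀ Γ ∈ 𝓕, nuclearNorm Γ ≤ r)
    (hγ : ∀ Γ ∈ 𝓕, ∀ u i, Γ u i ∈ Set.Icc (-γ) γ)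
    (hg : ∀ x ∈ Set.Icc (-γ) γ, ∀ y ∈ Set.Icc (-γ) γ, |g x - g y| ≤ L * |x - y|)
    (Q : Finset (Fin m × Fin n) → Prop) [DecidablePred Q]
    (hQ : ∀ R, Q R → ∃ Γ ∈ 𝓕, L * (2 * r) * t <
      ∑ k : Fin m × Fin n, ((if k ∈ R then 1 else 0) - p k) * (g (Γ k.1 k.2) - g (A k.1 k.2))) :
    ∑ R with Q R, maskWeight p R ≤ 5 ^ (m + n) * Real.exp (-t ^ 2 / 32) := by
  have hgA : ∀ Γ ∈ 𝓕, ∀ u i, |g (Γ u i) - g (A u i)| ≤ L * |Γ u i - A u i| :=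
    fun Γ hΓ u i => hg _ (hγ Γ hΓ u i) _ (hγ A hA u i)
  -- If `L = 0` then `g` is constant on the range and no deviation occurs; below, `θ` divides by
  -- `L`.
  rcases hL.eq_or_lt with rfl | hL
  · rw [Finset.sum_eq_zero fun R hR => ?_]
    · positivity
    · obtain ⟨Γ, hΓ, h⟩ := hQ R (Finset.mem_filter.1 hR).2
      have h0 : ∀ k : Fin m × Fin n, g (Γ k.1 k.2) - g (A k.1 k.2) = 0 := fun k =>
        abs_nonpos_iff.1 ((hgA Γ hΓ k.1 k.2).trans (by simp))
      simp [h0] at h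
  have hsel : ∀ R, ∃ Γ ∈ 𝓕, Q R → L * (2 * r) * t <
      ∑ k : Fin m × Fin n, ((if k ∈ R then 1 else 0) - p k) * (g (Γ k.1 k.2) - g (A k.1 k.2)) := by
    intro R
    by_cases h : Q R
    · obtain ⟨Γ, hΓ, h'⟩ := hQ R h
      exact ⟨Γ, hΓ, fun _ => h'⟩
    · exact ⟨A, hA, fun h' => absurd h' h⟩
  choose G hG𝓕 hGQ using hsel
  -- With `s = θ * L * (2 * r)` the Chernoff exponent is `8 * s ^ 2 - s * t`, minimized at `s = t /
  -- 16` with value `-t ^ 2 / 32`.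
  set θ : ℝ := t / (16 * (L * (2 * r))) with hθ
  have hθ0 : 0 ≤ θ := by positivity
  have hcmp := bernoulli_le_rademacher Finset.univ p hp
    (fun k R => (θ * L) * (G R k.1 k.2 - A k.1 k.2))
    (fun k R => θ * (g (G R k.1 k.2) - g (A k.1 k.2)))
    (fun k R => by
      rw [abs_mul, abs_mul, abs_of_nonneg hθ0, abs_of_nonneg (mul_nonneg hθ0 hL.le), mul_assoc]
      exact mul_le_mul_of_nonneg_left (hgA _ (hG𝓕 R) _ _) hθ0)
    (fun k R R' => by
      rw [← mul_sub, ← mul_sub, abs_mul, abs_mul, abs_of_nonneg hθ0,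
        abs_of_nonneg (mul_nonneg hθ0 hL.le), mul_assoc, sub_sub_sub_cancel_right,
        sub_sub_sub_cancel_right]
      exact mul_le_mul_of_nonneg_left
        (hg _ (hγ _ (hG𝓕 R) _ _) _ (hγ _ (hG𝓕 R') _ _)) hθ0) (fun _ => 0)
  -- The radius `2 * r` for `G R - A` comes from applying duality to `G R` with `D` and to `A` with
  -- `-D`, so the triangle inequality for the nuclear norm is not needed.
  have hrad := sum_exp_iSup_nuclearNorm_le (fun R => G R - A) (κ := θ * L) (r := 2 * r)
    (by positivity) (fun R D B hB hD => by
      have h1 := sum_mul_le_nuclearNorm D (G R) hD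
      have h2 := sum_mul_le_nuclearNorm (-D) A (B := B) (fun x => by
        rw [map_neg, LinearMap.neg_apply, norm_neg]; exact hD x)
      have h3 := mul_le_mul_of_nonneg_left (hnuc _ (hG𝓕 R)) hB
      have h4 := mul_le_mul_of_nonneg_left (hnuc A hA) hB
      have h5 : ∑ u, ∑ i, D u i * (G R - A) u i =
          ∑ u, ∑ i, D u i * G R u i + ∑ u, ∑ i, (-D) u i * A u i := by
        simp only [← Finset.sum_add_distrib, Matrix.sub_apply, Matrix.neg_apply]
        exact Finset.sum_congr rfl fun u _ => Finset.sum_congr rfl fun i _ => by ring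
      rw [h5]
      linarith)
  simp only [Finset.powerset_univ, zero_add, Finset.card_univ, Fintype.card_prod,
    Fintype.card_fin] at hcmp
  have hcmp' : ∑ R, maskWeight p R * Real.exp (⨆ R', ∑ k : Fin m × Fin n,
      ((if k ∈ R then 1 else 0) - p k) * (θ * (g (G R' k.1 k.2) - g (A k.1 k.2)))) ≤
      5 ^ (m + n) * Real.exp (8 * (θ * L * (2 * r)) ^ 2) := by
    refine hcmp.trans (le_trans (le_of_eq ?_) hrad)
    refine Finset.sum_congr rfl fun R _ => ?_
    congr 3
    ext R'
    rw [Fintype.sum_prod_type, Finset.mul_sum]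
    refine Finset.sum_congr rfl fun u _ => ?_
    rw [Finset.mul_sum]
    refine Finset.sum_congr rfl fun i _ => ?_
    simp only [signMatrix, Matrix.sub_apply]
    ring
  have hθL : θ * L * (2 * r) = t / 16 := by
    rw [hθ]; field_simp
  rw [hθL] at hcmp'
  have hlow : ∑ R with Q R, maskWeight p R * Real.exp (t ^ 2 / 16) ≤
      5 ^ (m + n) * Real.exp (8 * (t / 16) ^ 2) := by
    refine le_trans ?_ hcmp'
    refine le_trans (Finset.sum_le_sum fun R hR => ?_)
      (Finset.sum_le_sum_of_subset_of_nonneg (Finset.filter_subset _ _) fun R _ _ =>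
        mul_nonneg (maskWeight_nonneg hp R) (Real.exp_pos _).le)
    refine mul_le_mul_of_nonneg_left (Real.exp_le_exp.2 ?_) (maskWeight_nonneg hp R)
    refine le_trans ?_ (le_ciSup (f := fun R' => ∑ k : Fin m × Fin n,
      ((if k ∈ R then 1 else 0) - p k) * (θ * (g (G R' k.1 k.2) - g (A k.1 k.2))))
      (Set.finite_range _).bddAbove R)
    have h1 := mul_le_mul_of_nonneg_left (hGQ R (Finset.mem_filter.1 hR).2).le hθ0
    calc t ^ 2 / 16 = θ * L * (2 * r) * t := by rw [hθL]; ring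
      _ = θ * (L * (2 * r) * t) := by ring
      _ ≤ _ := h1
      _ = _ := by
        rw [Finset.mul_sum]
        exact Finset.sum_congr rfl fun k _ => by ring
  rw [← Finset.sum_mul] at hlow
  have h6 : Real.exp (8 * (t / 16) ^ 2) = Real.exp (-t ^ 2 / 32) * Real.exp (t ^ 2 / 16) := by
    rw [← Real.exp_add]; congr 1; ring
  rw [h6, ← mul_assoc] at hlow
  exact le_of_mul_le_mul_right hlow (Real.exp_pos _)

/-! ### Pinsker's inequality for Bernoulli distributions -/

/-- The Kullback-Leibler divergence between Bernoulli distributions. -/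
noncomputable def klBernoulli (p q : ℝ) : ℝ :=
  p * (Real.log p - Real.log q) + (1 - p) * (Real.log (1 - p) - Real.log (1 - q))

/-- As a function of `q`, the difference vanishes at `p`, and its derivative has the sign of `q - p`
because `4 x (1 - x) ≤ 1`. -/
lemma two_mul_sq_le_klBernoulli {p q : ℝ} (hp : p ∈ Set.Ioo (0 : ℝ) 1)
    (hq : q ∈ Set.Ioo (0 : ℝ) 1) : 2 * (q - p) ^ 2 ≤ klBernoulli p q := by
  set f : ℝ → ℝ := fun q => klBernoulli p q - 2 * (q - p) ^ 2 with hf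
  have hderiv : ∀ x ∈ Set.Ioo (0 : ℝ) 1,
      HasDerivAt f ((x - p) * (1 - 4 * (x * (1 - x))) / (x * (1 - x))) x := by
    intro x hx
    have hx0 : x ≠ 0 := hx.1.ne'
    have hx1 : 1 - x ≠ 0 := (sub_pos.2 hx.2).ne'
    have h1 := (Real.hasDerivAt_log hx0).const_sub (Real.log p) |>.const_mul p
    have h2 := (((hasDerivAt_id x).const_sub 1).log hx1).const_sub (Real.log (1 - p))
      |>.const_mul (1 - p)
    have h3 := (((hasDerivAt_id x).sub_const p).pow 2).const_mul 2
    refine ((h1.add h2).sub h3).congr_deriv ?_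
    simp only [id_eq]
    field_simp
    ring
  have hfp : f p = 0 := by simp [hf, klBernoulli]
  have hquad : ∀ x : ℝ, 0 ≤ 1 - 4 * (x * (1 - x)) := fun x => by nlinarith [sq_nonneg (1 - 2 * x)]
  suffices 0 ≤ f q by simp only [hf] at this; linarith
  rcases le_total p q with hpq | hpq
  · have hsub : Set.Icc p q ⊆ Set.Ioo 0 1 := fun x hx =>
      ⟨hp.1.trans_le hx.1, hx.2.trans_lt hq.2⟩
    have hmono : MonotoneOn f (Set.Icc p q) := by
      refine monotoneOn_of_deriv_nonneg (convex_Icc _ _)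
        (fun x hx => (hderiv x (hsub hx)).continuousAt.continuousWithinAt)
        (fun x hx => (hderiv x (hsub (interior_subset hx))).differentiableAt.differentiableWithinAt)
        fun x hx => ?_
      have hx' := interior_subset hx
      rw [(hderiv x (hsub hx')).deriv]
      exact div_nonneg (mul_nonneg (sub_nonneg.2 hx'.1) (hquad x))
        (mul_nonneg (hsub hx').1.le (sub_nonneg.2 (hsub hx').2.le))
    rw [← hfp]
    exact hmono (Set.left_mem_Icc.2 hpq) (Set.right_mem_Icc.2 hpq) hpq
  · have hsub : Set.Icc q p ⊆ Set.Ioo 0 1 := fun x hx =>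
      ⟨hq.1.trans_le hx.1, hx.2.trans_lt hp.2⟩
    have hanti : AntitoneOn f (Set.Icc q p) := by
      refine antitoneOn_of_deriv_nonpos (convex_Icc _ _)
        (fun x hx => (hderiv x (hsub hx)).continuousAt.continuousWithinAt)
        (fun x hx => (hderiv x (hsub (interior_subset hx))).differentiableAt.differentiableWithinAt)
        fun x hx => ?_
      have hx' := interior_subset hx
      rw [(hderiv x (hsub hx')).deriv]
      exact div_nonpos_of_nonpos_of_nonneg
        (mul_nonpos_of_nonpos_of_nonneg (sub_nonpos.2 hx'.2) (hquad x))
        (mul_nonneg (hsub hx').1.le (sub_nonneg.2 (hsub hx').2.le))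
    rw [← hfp]
    exact hanti (Set.left_mem_Icc.2 hpq) (Set.right_mem_Icc.2 hpq) hpq

/-! ### The link function -/

/-- The log-odds of the link. -/
noncomputable def logOdds (σ : ℝ → ℝ) (x : ℝ) : ℝ := Real.log (σ x) - Real.log (1 - σ x)

lemma linkConst_nonneg {σ : ℝ → ℝ} {γ : ℝ} (h : AdmissibleLink σ γ) : 0 ≤ linkConst σ γ := by
  refine Real.sSup_nonneg ?_
  rintro _ ⟨x, hx, rfl⟩
  have := h.mem_Ioo x hx
  exact div_nonneg (abs_nonneg _) (mul_nonneg this.1.le (sub_nonneg.2 this.2.le))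

/-- The derivative of the log-odds is `σ' / (σ (1 - σ))`, which `linkConst` bounds on the interval.
-/
lemma AdmissibleLink.abs_logOdds_sub_le {σ : ℝ → ℝ} {γ : ℝ} (h : AdmissibleLink σ γ) :
    ∀ x ∈ Set.Icc (-γ) γ, ∀ y ∈ Set.Icc (-γ) γ,
      |logOdds σ x - logOdds σ y| ≤ linkConst σ γ * |x - y| := by
  intro x hx y hy
  have hd : ∀ z ∈ Set.Icc (-γ) γ,
      HasDerivWithinAt (logOdds σ) (deriv σ z / (σ z * (1 - σ z))) (Set.Icc (-γ) γ) z := by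
    intro z hz
    have hz' := h.mem_Ioo z hz
    have h0 : σ z ≠ 0 := hz'.1.ne'
    have h1 : 1 - σ z ≠ 0 := (sub_pos.2 hz'.2).ne'
    have hs := (h.differentiable z).hasDerivAt
    refine (((hs.log h0).sub ((hs.const_sub 1).log h1)).congr_deriv ?_).hasDerivWithinAt
    field_simp
    ring
  refine (convex_Icc (-γ) γ).norm_image_sub_le_of_norm_hasDerivWithin_le hd (fun z hz => ?_) hy hx
  have hz' := h.mem_Ioo z hz
  rw [Real.norm_eq_abs, abs_div,
    abs_of_nonneg (mul_nonneg hz'.1.le (sub_nonneg.2 hz'.2.le))]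
  exact le_csSup h.bddAbove ⟨z, hz, rfl⟩

lemma admissibleLink_sigmoid (γ : ℝ) (hγ : 0 < γ) :
    AdmissibleLink Real.sigmoid γ ∧ linkConst Real.sigmoid γ = 1 := by
  have himg : (fun x => |deriv Real.sigmoid x| / (Real.sigmoid x * (1 - Real.sigmoid x))) ''
      Set.Icc (-γ) γ = {1} := by
    have : (fun x => |deriv Real.sigmoid x| / (Real.sigmoid x * (1 - Real.sigmoid x))) =
        fun _ => 1 := by
      ext x
      have h := mul_pos (Real.sigmoid_pos x) (sub_pos.2 (Real.sigmoid_lt_one x))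
      rw [Real.deriv_sigmoid, abs_of_pos h, div_self h.ne']
    rw [this, Set.Nonempty.image_const (Set.nonempty_Icc.2 (by linarith))]
  refine ⟨⟨fun x => ⟨Real.sigmoid_nonneg x, Real.sigmoid_le_one x⟩, differentiable_sigmoid,
    fun x _ => ⟨Real.sigmoid_pos x, Real.sigmoid_lt_one x⟩, ?_⟩, ?_⟩
  · rw [himg]; exact bddAbove_singleton
  · rw [linkConst, himg, csSup_singleton]

/-! ### Entrywise bounds -/

lemma abs_apply_le_maxNorm {m n : ℕ} (A : Matrix (Fin m) (Fin n) ℝ) (u : Fin m) (i : Fin n) :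
    |A u i| ≤ maxNorm A :=
  le_ciSup (f := fun p : Fin m × Fin n => |A p.1 p.2|) (Set.finite_range _).bddAbove (u, i)

lemma mem_Icc_of_maxNorm_le {m n : ℕ} {A : Matrix (Fin m) (Fin n) ℝ} {γ : ℝ}
    (h : maxNorm A ≤ γ) (u : Fin m) (i : Fin n) : A u i ∈ Set.Icc (-γ) γ :=
  abs_le.1 ((abs_apply_le_maxNorm A u i).trans h)

/-! ### The maximum likelihood estimator -/

/-- Splits the likelihood ratio into its fluctuation, linear in the mask, and its mean when the mask
has mean `σ(A)`, which is minus the KL divergence. -/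
lemma logLik_sub_logLik {m n : ℕ} (σ : ℝ → ℝ) (M Γ A : Matrix (Fin m) (Fin n) ℝ) :
    logLik σ M Γ - logLik σ M A =
      ∑ k : Fin m × Fin n, (M k.1 k.2 - σ (A k.1 k.2)) *
        (logOdds σ (Γ k.1 k.2) - logOdds σ (A k.1 k.2)) -
      ∑ k : Fin m × Fin n, klBernoulli (σ (A k.1 k.2)) (σ (Γ k.1 k.2)) := by
  simp only [logLik, logOdds, klBernoulli, Fintype.sum_prod_type, ← Finset.sum_sub_distrib]
  exact Finset.sum_congr rfl fun u _ => Finset.sum_congr rfl fun i _ => by ring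

lemma sum_sq_le_of_isMaxOn {m n : ℕ} {σ : ℝ → ℝ} {γ : ℝ} (h : AdmissibleLink σ γ)
    {𝓕 : Set (Matrix (Fin m) (Fin n) ℝ)} {M A Γ : Matrix (Fin m) (Fin n) ℝ} (hA : A ∈ 𝓕)
    (hmax : IsMaxOn (logLik σ M) 𝓕 Γ) (hAγ : maxNorm A ≤ γ) (hΓγ : maxNorm Γ ≤ γ) :
    2 * ∑ u, ∑ i, (σ (Γ u i) - σ (A u i)) ^ 2 ≤
      ∑ k : Fin m × Fin n, (M k.1 k.2 - σ (A k.1 k.2)) *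
        (logOdds σ (Γ k.1 k.2) - logOdds σ (A k.1 k.2)) := by
  have h1 : logLik σ M A ≤ logLik σ M Γ := hmax hA
  have h2 := logLik_sub_logLik σ M Γ A
  have h3 : 2 * ∑ u, ∑ i, (σ (Γ u i) - σ (A u i)) ^ 2 ≤
      ∑ k : Fin m × Fin n, klBernoulli (σ (A k.1 k.2)) (σ (Γ k.1 k.2)) := by
    rw [← Fintype.sum_prod_type' (f := fun u i => (σ (Γ u i) - σ (A u i)) ^ 2), Finset.mul_sum]
    exact Finset.sum_le_sum fun k _ => two_mul_sq_le_klBernoulli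
      (h.mem_Ioo _ (mem_Icc_of_maxNorm_le hAγ _ _)) (h.mem_Ioo _ (mem_Icc_of_maxNorm_le hΓγ _ _))
  linarith

/-! ### Concentration of the inverse-propensity-scored loss -/

lemma two_sided_hoeffding {ι 𝓞 : Type*} [Fintype ι] [MeasurableSpace 𝓞] {μ : Measure 𝓞}
    [IsProbabilityMeasure μ] {Y : ι → 𝓞 → ℝ} (hind : iIndepFun Y μ)
    (hmeas : ∀ k, Measurable (Y k)) {b : ℝ} (hY : ∀ k ω, Y k ω ∈ Set.Icc 0 b) {ε : ℝ}
    (hε : 0 ≤ ε) :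
    μ.real {ω | ε ≤ |∑ k, (Y k ω - μ[Y k])|} ≤
      2 * Real.exp (-(2 * ε ^ 2) / (Fintype.card ι * b ^ 2)) := by
  have hsub : ∀ k ∈ Finset.univ,
      HasSubgaussianMGF (fun ω => Y k ω - μ[Y k]) ((‖b - 0‖₊ / 2) ^ 2) μ := fun k _ =>
    hasSubgaussianMGF_of_mem_Icc (hmeas k).aemeasurable (Filter.Eventually.of_forall (hY k))
  have hind' : iIndepFun (fun k ω => Y k ω - μ[Y k]) μ :=
    hind.comp (fun k (y : ℝ) => y - ∫ ω, Y k ω ∂μ) fun k => measurable_id.sub_const _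
  have hsum := HasSubgaussianMGF.sum_of_iIndepFun hind' hsub
  have hexp : Real.exp (-ε ^ 2 / (2 * (∑ _k : ι, (‖b - 0‖₊ / 2) ^ 2 : NNReal))) =
      Real.exp (-(2 * ε ^ 2) / (Fintype.card ι * b ^ 2)) := by
    congr 1
    push_cast
    rw [Finset.sum_const, Finset.card_univ, nsmul_eq_mul, sub_zero, Real.norm_eq_abs, div_pow,
      sq_abs]
    have : (2 : ℝ) * (Fintype.card ι * (b ^ 2 / 2 ^ 2)) = (Fintype.card ι * b ^ 2) / 2 := by ring
    rw [this, div_div_eq_mul_div]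
    ring
  have h1 := hsum.measure_ge_le hε
  have h2 := hsum.neg.measure_ge_le hε
  rw [hexp] at h1 h2
  have hcover : {ω | ε ≤ |∑ k, (Y k ω - μ[Y k])|} ⊆
      {ω | ε ≤ ∑ k, (Y k ω - μ[Y k])} ∪ {ω | ε ≤ (-fun ω => ∑ k, (Y k ω - μ[Y k])) ω} :=
    fun ω (hω : ε ≤ |∑ k, (Y k ω - μ[Y k])|) => le_abs.1 hω
  refine (measureReal_mono hcover (measure_ne_top _ _)).trans
    ((measureReal_union_le _ _).trans ?_)
  linarith

lemma ipsMSE_eq {m n : ℕ} {X : Matrix (Fin m) (Fin n) (Option ℝ)}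
    {Xstar : Matrix (Fin m) (Fin n) ℝ} (hX : ∀ u i, X u i = none ∨ X u i = some (Xstar u i))
    (Shat P : Matrix (Fin m) (Fin n) ℝ) :
    ipsMSE X Shat P = 1 / ((m : ℝ) * n) * ∑ k : Fin m × Fin n,
      if X k.1 k.2 ≠ none then (Shat k.1 k.2 - Xstar k.1 k.2) ^ 2 / P k.1 k.2 else 0 := by
  rw [ipsMSE, ← Finset.sum_filter]
  congr 1
  refine Finset.sum_congr ?_ fun k hk => ?_
  · ext k; simp [mem_revealed]
  · rw [(hX k.1 k.2).resolve_left (Finset.mem_filter.1 hk).2]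
    rfl

/-- Weighting by the true propensity makes each summand unbiased for the squared error and confines
it to `[0, 4 * ψ ^ 2 / c]`, so Hoeffding's inequality applies. -/
lemma RevealsIndependently.ipsMSE_deviation {m n : ℕ} (hm : 0 < m) (hn : 0 < n) {𝓞 : Type*}
    [MeasurableSpace 𝓞] {μ : Measure 𝓞} [IsProbabilityMeasure μ]
    {Xstar P : Matrix (Fin m) (Fin n) ℝ} {X : 𝓞 → Matrix (Fin m) (Fin n) (Option ℝ)}
    (h : RevealsIndependently μ Xstar P X) {Shat : Matrix (Fin m) (Fin n) ℝ} {ψ c δ : ℝ}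
    (hψ : 0 < ψ) (hc : 0 < c) (hδ : δ ∈ Set.Ioo (0 : ℝ) 1) (hP : ∀ u i, c ≤ P u i)
    (hS : ∀ u i, (Shat u i - Xstar u i) ^ 2 ≤ 4 * ψ ^ 2) :
    μ.real {ω | 4 * ψ ^ 2 / c * √(1 / (2 * (m : ℝ) * n) * Real.log (2 / δ)) <
      |ipsMSE (X ω) Shat P - fullMSE Xstar Shat|} ≤ δ := by
  classical
  set N : ℝ := (m : ℝ) * n with hN
  have hN0 : 0 < N := by positivity
  set s : ℝ := 4 * ψ ^ 2 / c * √(1 / (2 * (m : ℝ) * n) * Real.log (2 / δ)) with hs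
  have hs0 : 0 ≤ s := by positivity
  set v : Fin m × Fin n → ℝ := fun k => (Shat k.1 k.2 - Xstar k.1 k.2) ^ 2 / P k.1 k.2 with hv
  set E : Fin m × Fin n → Set 𝓞 := fun k => {ω | X ω k.1 k.2 ≠ none} with hE
  set Y : Fin m × Fin n → 𝓞 → ℝ := fun k ω => (E k).indicator (fun _ => (1 : ℝ)) ω * v k with hY
  have hv0 : ∀ k, 0 ≤ v k := fun k => div_nonneg (sq_nonneg _) (hc.le.trans (hP _ _))
  have hvb : ∀ k, v k ≤ 4 * ψ ^ 2 / c := fun k =>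
    div_le_div₀ (by positivity) (hS _ _) hc (hP _ _)
  have hmeas : ∀ k, Measurable (Y k) := fun k =>
    (measurable_const.indicator (h.measurableSet k.1 k.2)).mul_const _
  have hind : iIndepFun Y μ :=
    (h.indep.iIndepFun_indicator (β := ℝ)).comp (fun k (y : ℝ) => y * v k)
      fun k => measurable_id.mul_const _
  have hint : ∀ k, μ[Y k] = (Shat k.1 k.2 - Xstar k.1 k.2) ^ 2 := fun k => by
    have h1 : μ[Y k] = P k.1 k.2 * v k := by
      simp only [hY]
      rw [integral_mul_const, integral_indicator_const _ (h.measurableSet k.1 k.2), h.prob]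
      simp
    rw [h1, hv]
    exact mul_div_cancel₀ _ (hc.trans_le (hP _ _)).ne'
  have hYmem : ∀ k ω, Y k ω ∈ Set.Icc 0 (4 * ψ ^ 2 / c) := fun k ω => by
    by_cases hω : ω ∈ E k
    · simpa [hY, hω] using ⟨hv0 k, hvb k⟩
    · simp only [hY, Set.indicator_of_notMem hω, zero_mul]
      exact ⟨le_rfl, by positivity⟩
  have hdiff : ∀ ω, ipsMSE (X ω) Shat P - fullMSE Xstar Shat =
      1 / N * ∑ k, (Y k ω - μ[Y k]) := fun ω => by
    rw [ipsMSE_eq (h.eq_none_or ω), fullMSE,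
      ← Fintype.sum_prod_type' (f := fun u i => (Shat u i - Xstar u i) ^ 2), ← mul_sub,
      ← Finset.sum_sub_distrib]
    congr 1
    refine Finset.sum_congr rfl fun k _ => ?_
    rw [hint]
    simp [hY, hE, hv, Set.indicator_apply]
  have hhoef := two_sided_hoeffding hind hmeas hYmem (ε := N * s) (by positivity)
  refine (measureReal_mono (fun ω hω => ?_) (measure_ne_top _ _)).trans (hhoef.trans (le_of_eq ?_))
  · have hω' : s < |ipsMSE (X ω) Shat P - fullMSE Xstar Shat| := hω
    rw [hdiff, abs_mul, abs_of_pos (by positivity), one_div_mul_eq_div, lt_div_iff₀ hN0] at hω'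
    show N * s ≤ _
    linarith
  · have hlog : 0 ≤ Real.log (2 / δ) :=
      Real.log_nonneg ((one_le_div hδ.1).2 (by linarith [hδ.2]))
    have harg : -(2 * (N * s) ^ 2) / ((Fintype.card (Fin m × Fin n) : ℝ) * (4 * ψ ^ 2 / c) ^ 2) =
        -Real.log (2 / δ) := by
      have hcard : (Fintype.card (Fin m × Fin n) : ℝ) = N := by simp [hN]
      rw [hcard, hs, mul_pow N, mul_pow _ (√_), Real.sq_sqrt (by positivity),
        mul_assoc 2 (m : ℝ), ← hN]
      field_simp
    rw [harg, Real.exp_neg, Real.exp_log (by have := hδ.1; positivity)]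
    field_simp

/-- The inverse-propensity-scored loss is stable under perturbation of the propensities. -/
lemma abs_ipsMSE_sub_le {m n : ℕ} (hm : 0 < m) (hn : 0 < n)
    {X : Matrix (Fin m) (Fin n) (Option ℝ)} {Xstar : Matrix (Fin m) (Fin n) ℝ}
    (hX : ∀ u i, X u i = none ∨ X u i = some (Xstar u i)) {Shat P P' : Matrix (Fin m) (Fin n) ℝ}
    {ψ c c' : ℝ} (hc : 0 < c) (hc' : 0 < c') (hP : ∀ u i, c ≤ P u i) (hP' : ∀ u i, c' ≤ P' u i)
    (hS : ∀ u i, (Shat u i - Xstar u i) ^ 2 ≤ 4 * ψ ^ 2) :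
    |ipsMSE X Shat P' - ipsMSE X Shat P| ≤ 4 * ψ ^ 2 / (c' * c) *
      √(1 / ((m : ℝ) * n) * ∑ u, ∑ i, (P' u i - P u i) ^ 2) := by
  classical
  set N : ℝ := (m : ℝ) * n with hN
  have hN0 : 0 < N := by positivity
  have hterm : ∀ k : Fin m × Fin n,
      |(if X k.1 k.2 ≠ none then (Shat k.1 k.2 - Xstar k.1 k.2) ^ 2 / P' k.1 k.2 else 0) -
        (if X k.1 k.2 ≠ none then (Shat k.1 k.2 - Xstar k.1 k.2) ^ 2 / P k.1 k.2 else 0)| ≤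
      4 * ψ ^ 2 / (c' * c) * |P' k.1 k.2 - P k.1 k.2| := by
    intro k
    have hp := hc.trans_le (hP k.1 k.2)
    have hp' := hc'.trans_le (hP' k.1 k.2)
    split_ifs
    · have he : (Shat k.1 k.2 - Xstar k.1 k.2) ^ 2 / P' k.1 k.2 -
          (Shat k.1 k.2 - Xstar k.1 k.2) ^ 2 / P k.1 k.2 =
          (Shat k.1 k.2 - Xstar k.1 k.2) ^ 2 / (P' k.1 k.2 * P k.1 k.2) *
            (P k.1 k.2 - P' k.1 k.2) := by
        field_simp
      rw [he, abs_mul, abs_sub_comm (P k.1 k.2),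
        abs_of_nonneg (div_nonneg (sq_nonneg _) (mul_pos hp' hp).le)]
      refine mul_le_mul_of_nonneg_right (div_le_div₀ (by positivity) (hS _ _) (by positivity) ?_)
        (abs_nonneg _)
      exact mul_le_mul (hP' _ _) (hP _ _) hc.le hp'.le
    · simp only [sub_self, abs_zero]
      positivity
  -- Cauchy–Schwarz: the mean absolute error is at most the root mean squared error.
  have hcs : 1 / N * ∑ k : Fin m × Fin n, |P' k.1 k.2 - P k.1 k.2| ≤
      √(1 / N * ∑ u, ∑ i, (P' u i - P u i) ^ 2) := by
    refine Real.le_sqrt_of_sq_le ?_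
    rw [← Fintype.sum_prod_type' (f := fun u i => (P' u i - P u i) ^ 2)]
    have h1 := sq_sum_le_card_mul_sum_sq (s := Finset.univ)
      (f := fun k : Fin m × Fin n => |P' k.1 k.2 - P k.1 k.2|)
    simp only [sq_abs, Finset.card_univ, Fintype.card_prod, Fintype.card_fin, Nat.cast_mul,
      ← hN] at h1
    rw [mul_pow]
    calc _ ≤ (1 / N) ^ 2 * (N * ∑ k : Fin m × Fin n, (P' k.1 k.2 - P k.1 k.2) ^ 2) :=
          mul_le_mul_of_nonneg_left h1 (by positivity)
      _ = _ := by field_simp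
  rw [ipsMSE_eq hX, ipsMSE_eq hX, ← mul_sub, ← Finset.sum_sub_distrib, abs_mul,
    abs_of_pos (show 0 < 1 / N by positivity)]
  calc _ ≤ 1 / N * ∑ k : Fin m × Fin n,
        4 * ψ ^ 2 / (c' * c) * |P' k.1 k.2 - P k.1 k.2| :=
        mul_le_mul_of_nonneg_left ((Finset.abs_sum_le_sum_abs _ _).trans
          (Finset.sum_le_sum fun k _ => hterm k)) (by positivity)
    _ = 4 * ψ ^ 2 / (c' * c) * (1 / N * ∑ k : Fin m × Fin n, |P' k.1 k.2 - P k.1 k.2|) := by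
        rw [← Finset.mul_sum]; ring
    _ ≤ _ := mul_le_mul_of_nonneg_left hcs (by positivity)

/-! ### Assembling the bounds -/

/-- Here `5 ≤ exp 2` and `6 ≤ (exp 1) ^ 2`, so the exponent `e² (√m + √n)² / 2 ≥ 3 (m + n)` beats
the entropy `2 (m + n)` of the nets and leaves `exp (-(m + n))`. -/
lemma net_tail_le {m n : ℕ} (hm : 0 < m) :
    5 ^ (m + n) * Real.exp (-(4 * Real.exp 1 * (√(m : ℝ) + √(n : ℝ))) ^ 2 / 32) ≤
      1 / ((m : ℝ) + n) := by
  have hM : 0 < (m : ℝ) + n := by positivity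
  have he : (2.7 : ℝ) ≤ Real.exp 1 := by linarith [Real.exp_one_gt_d9]
  have h5 : (5 : ℝ) ≤ Real.exp 2 := by
    have : Real.exp 2 = Real.exp 1 * Real.exp 1 := by rw [← Real.exp_add]; norm_num
    nlinarith
  have hsq : (m : ℝ) + n ≤ (√(m : ℝ) + √(n : ℝ)) ^ 2 := by
    have h1 := Real.sq_sqrt (Nat.cast_nonneg (α := ℝ) m)
    have h2 := Real.sq_sqrt (Nat.cast_nonneg (α := ℝ) n)
    nlinarith [mul_nonneg (Real.sqrt_nonneg (m : ℝ)) (Real.sqrt_nonneg (n : ℝ))]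
  have h3 : 6 * ((m : ℝ) + n) ≤ Real.exp 1 ^ 2 * (√(m : ℝ) + √(n : ℝ)) ^ 2 :=
    mul_le_mul (by nlinarith) hsq hM.le (by positivity)
  calc _ ≤ Real.exp 2 ^ (m + n) *
        Real.exp (-(4 * Real.exp 1 * (√(m : ℝ) + √(n : ℝ))) ^ 2 / 32) := by gcongr
    _ = Real.exp (2 * ((m : ℝ) + n) -
          Real.exp 1 ^ 2 * (√(m : ℝ) + √(n : ℝ)) ^ 2 / 2) := by
        rw [← Real.exp_nat_mul, ← Real.exp_add]
        congr 1
        push_cast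
        ring
    _ ≤ Real.exp (-((m : ℝ) + n)) := Real.exp_le_exp.2 (by linarith)
    _ = 1 / Real.exp ((m : ℝ) + n) := by rw [Real.exp_neg, one_div]
    _ ≤ 1 / ((m : ℝ) + n) :=
        one_div_le_one_div_of_le hM (by linarith [Real.add_one_le_exp ((m : ℝ) + n)])

/-- The logarithmic likelihood ratio at a feasible matrix deviates by more than the threshold. -/
def DeviationEvent {m n : ℕ} (σ : ℝ → ℝ) (τ γ K : ℝ) (A : Matrix (Fin m) (Fin n) ℝ)
    (R : Finset (Fin m × Fin n)) : Prop :=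
  ∃ Γ ∈ feasible m n τ γ, K < ∑ k : Fin m × Fin n, ((if k ∈ R then 1 else 0) - σ (A k.1 k.2)) *
    (logOdds σ (Γ k.1 k.2) - logOdds σ (A k.1 k.2))

lemma measureReal_deviationEvent_le {m n : ℕ} (hm : 0 < m) (hn : 0 < n) {σ : ℝ → ℝ} {τ γ : ℝ}
    (hτ : 0 < τ) (h : AdmissibleLink σ γ) {A : Matrix (Fin m) (Fin n) ℝ}
    (hA : A ∈ feasible m n τ γ) {𝓞 : Type*} [MeasurableSpace 𝓞] {μ : Measure 𝓞}
    [IsProbabilityMeasure μ] {Xstar : Matrix (Fin m) (Fin n) ℝ}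
    {X : 𝓞 → Matrix (Fin m) (Fin n) (Option ℝ)}
    (hX : RevealsIndependently μ Xstar (A.map σ) X) :
    μ.real {ω | DeviationEvent σ τ γ (linkConst σ γ * (2 * (τ * √((m : ℝ) * n))) *
      (4 * Real.exp 1 * (√(m : ℝ) + √(n : ℝ)))) A (revealed (X ω))} ≤ 1 / ((m : ℝ) + n) := by
  classical
  refine (hX.measureReal_le_sum (DeviationEvent σ τ γ (linkConst σ γ *
    (2 * (τ * √((m : ℝ) * n))) * (4 * Real.exp 1 * (√(m : ℝ) + √(n : ℝ)))) A)).trans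
    (le_trans ?_ (net_tail_le (n := n) hm))
  exact maskWeight_deviation_le _ hX.prob_mem_Icc (feasible m n τ γ) A hA (by positivity)
    (linkConst_nonneg h) (by positivity) (logOdds σ) (fun Γ hΓ => hΓ.1)
    (fun Γ hΓ => mem_Icc_of_maxNorm_le hΓ.2) h.abs_logOdds_sub_le _ (fun R hR => hR)

/-- Off the bad event, twice the total squared error is at most `8 e L_γ τ √(mn) (√m + √n)`;
dividing by `2mn` gives the stated rate. -/
lemma mse_le_of_not_deviationEvent {m n : ℕ} (hm : 0 < m) (hn : 0 < n) {σ : ℝ → ℝ} {τ γ : ℝ}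
    (h : AdmissibleLink σ γ) {A Γ : Matrix (Fin m) (Fin n) ℝ}
    (hA : A ∈ feasible m n τ γ) (hΓ : Γ ∈ feasible m n τ γ)
    {X : Matrix (Fin m) (Fin n) (Option ℝ)}
    (hmax : IsMaxOn (logLik σ (mask X)) (feasible m n τ γ) Γ)
    (hX : ¬ DeviationEvent σ τ γ (linkConst σ γ * (2 * (τ * √((m : ℝ) * n))) *
      (4 * Real.exp 1 * (√(m : ℝ) + √(n : ℝ)))) A (revealed X)) :
    1 / ((m : ℝ) * n) * ∑ u, ∑ i, ((Γ.map σ) u i - (A.map σ) u i) ^ 2 ≤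
      4 * Real.exp 1 * linkConst σ γ * τ * (1 / √(m : ℝ) + 1 / √(n : ℝ)) := by
  have h1 := sum_sq_le_of_isMaxOn h hA hmax hA.2 hΓ.2
  simp only [mask_eq] at h1
  have h2 := not_lt.1 fun hlt => hX ⟨Γ, hΓ, hlt⟩
  have h3 := h1.trans h2
  simp only [Matrix.map_apply]
  rw [Real.sqrt_mul (Nat.cast_nonneg m)] at h3
  have hm' : 0 < √(m : ℝ) := by positivity
  have hn' : 0 < √(n : ℝ) := by positivity
  have hmn : (m : ℝ) * n = (√(m : ℝ) * √(n : ℝ)) ^ 2 := by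
    rw [mul_pow, Real.sq_sqrt (Nat.cast_nonneg m), Real.sq_sqrt (Nat.cast_nonneg n)]
  rw [hmn, one_div_mul_eq_div, div_le_iff₀ (by positivity)]
  refine le_trans (b := linkConst σ γ * (τ * (√(m : ℝ) * √(n : ℝ))) *
    (4 * Real.exp 1 * (√(m : ℝ) + √(n : ℝ)))) (by linarith) (le_of_eq ?_)
  field_simp
  ring

/-- Subadditivity of the square root, turning the rate for the mean squared error into the
fourth-root rate for the loss. -/
lemma sqrt_inv_sqrt_add_le (m n : ℕ) :
    √(1 / √(m : ℝ) + 1 / √(n : ℝ)) ≤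
      1 / (m : ℝ) ^ (1 / 4 : ℝ) + 1 / (n : ℝ) ^ (1 / 4 : ℝ) := by
  have hq : ∀ k : ℕ, 1 / √(k : ℝ) = (1 / (k : ℝ) ^ (1 / 4 : ℝ)) ^ 2 := fun k => by
    rw [div_pow, one_pow, ← Real.rpow_natCast, ← Real.rpow_mul (Nat.cast_nonneg k),
      Real.sqrt_eq_rpow]
    norm_num
  rw [hq, hq]
  have h1 : 0 ≤ 1 / (m : ℝ) ^ (1 / 4 : ℝ) := by positivity
  have h2 : 0 ≤ 1 / (n : ℝ) ^ (1 / 4 : ℝ) := by positivity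
  exact Real.sqrt_le_iff.2 ⟨by positivity, by nlinarith⟩

lemma sq_sub_le_four_mul_sq {x y ψ φ : ℝ} (hx : |x| ≤ ψ) (hy : |y| ≤ φ) (h : φ ≤ ψ) :
    (x - y) ^ 2 ≤ 4 * ψ ^ 2 := by
  have h1 := abs_sub x y
  have h2 : |x - y| ≤ 2 * ψ := by linarith
  have := sq_le_sq' (by linarith [abs_nonneg (x - y)]) h2
  rw [sq_abs] at this
  linarith

end OneBitMC

theorem theorem2 :
    (∃ C : ℝ, 0 < C ∧
      ∀ (m n : ℕ), 0 < m → 0 < n → C ≤ (m : ℝ) + n →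
      ∀ (σ : ℝ → ℝ) (θ α φ τ γ ψ δ : ℝ),
        0 < θ → 0 < α → 0 < φ → θ ≤ τ → α ≤ γ → φ ≤ ψ → δ ∈ Set.Ioo (0 : ℝ) 1 →
        OneBitMC.AdmissibleLink σ γ →
      ∀ (A S W Shat : Matrix (Fin m) (Fin n) ℝ),
        OneBitMC.nuclearNorm A ≤ θ * √((m : ℝ) * n) →
        OneBitMC.maxNorm A ≤ α →
        OneBitMC.maxNorm (S + W) ≤ φ →
        OneBitMC.maxNorm Shat ≤ ψ →
      ∀ {𝓞 : Type*} [MeasurableSpace 𝓞] (μ : Measure 𝓞) [IsProbabilityMeasure μ]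
        (X : 𝓞 → Matrix (Fin m) (Fin n) (Option ℝ)),
        OneBitMC.RevealsIndependently μ (S + W) (A.map σ) X →
        1 - C / ((m : ℝ) + n) - δ ≤
          μ.real {ω | ∀ Phat : Matrix (Fin m) (Fin n) ℝ,
            OneBitMC.IsOutput σ τ γ (OneBitMC.mask (X ω)) Phat →
            1 / ((m : ℝ) * n) * ∑ u, ∑ i, (Phat u i - (A.map σ) u i) ^ 2 ≤
              4 * Real.exp 1 * OneBitMC.linkConst σ γ * τ * (1 / √(m : ℝ) + 1 / √(n : ℝ)) ∧
            ((∀ x ∈ Set.Icc (-γ) γ, σ (-γ) ≤ σ x) → (∀ x ∈ Set.Icc (-α) α, σ (-α) ≤ σ x) →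
              |OneBitMC.ipsMSE (X ω) Shat Phat - OneBitMC.fullMSE (S + W) Shat| ≤
                8 * ψ ^ 2 * √(Real.exp 1 * OneBitMC.linkConst σ γ * τ) / (σ (-γ) * σ (-α)) *
                    (1 / (m : ℝ) ^ (1 / 4 : ℝ) + 1 / (n : ℝ) ^ (1 / 4 : ℝ)) +
                  4 * ψ ^ 2 / σ (-α) * √(1 / (2 * (m : ℝ) * n) * Real.log (2 / δ)))}) ∧
    (∀ γ : ℝ, 0 < γ → OneBitMC.AdmissibleLink Real.sigmoid γ ∧
      OneBitMC.linkConst Real.sigmoid γ = 1) := by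
  refine ⟨⟨1, one_pos, ?_⟩, OneBitMC.admissibleLink_sigmoid⟩
  intro m n hm hn _ σ θ α φ τ γ ψ δ hθ hα hφ hθτ hαγ hφψ hδ hσ A S W Shat hAnuc hAmax hXmax hSmax
    𝓞 _ μ _ X hX
  have hτ : 0 < τ := hθ.trans_le hθτ
  have hψ : 0 < ψ := hφ.trans_le hφψ
  have hAα := OneBitMC.mem_Icc_of_maxNorm_le hAmax
  have hA : A ∈ OneBitMC.feasible m n τ γ :=
    ⟨hAnuc.trans (mul_le_mul_of_nonneg_right hθτ (Real.sqrt_nonneg _)), hAmax.trans hαγ⟩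
  have hcα : 0 < σ (-α) := (hσ.mem_Ioo _ ⟨by linarith, by linarith⟩).1
  have hcγ : 0 < σ (-γ) := (hσ.mem_Ioo _ ⟨le_rfl, by linarith⟩).1
  have hS : ∀ u i, (Shat u i - (S + W) u i) ^ 2 ≤ 4 * ψ ^ 2 := fun u i =>
    OneBitMC.sq_sub_le_four_mul_sq ((OneBitMC.abs_apply_le_maxNorm _ _ _).trans hSmax)
      ((OneBitMC.abs_apply_le_maxNorm _ _ _).trans hXmax) hφψ
  set K := OneBitMC.linkConst σ γ * (2 * (τ * √((m : ℝ) * n))) *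
    (4 * Real.exp 1 * (√(m : ℝ) + √(n : ℝ))) with hK
  set B₁ := {ω | OneBitMC.DeviationEvent σ τ γ K A (OneBitMC.revealed (X ω))} with hB₁
  -- The minimality of `σ (-α)` is part of the event because Hoeffding's bound needs it while the
  -- first conclusion does not; if it fails, `B₂` is empty.
  set B₂ := {ω | (∀ x ∈ Set.Icc (-α) α, σ (-α) ≤ σ x) ∧
    4 * ψ ^ 2 / σ (-α) * √(1 / (2 * (m : ℝ) * n) * Real.log (2 / δ)) <
      |OneBitMC.ipsMSE (X ω) Shat (A.map σ) - OneBitMC.fullMSE (S + W) Shat|} with hB₂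
  have hμ₁ : μ.real B₁ ≤ 1 / ((m : ℝ) + n) :=
    OneBitMC.measureReal_deviationEvent_le hm hn hτ hσ hA hX
  have hμ₂ : μ.real B₂ ≤ δ := by
    by_cases hmin : ∀ x ∈ Set.Icc (-α) α, σ (-α) ≤ σ x
    · refine (measureReal_mono (fun ω hω => hω.2) (measure_ne_top _ _)).trans
        (hX.ipsMSE_deviation hm hn hψ hcα hδ (fun u i => hmin _ (hAα u i)) hS)
    · have : B₂ = ∅ := Set.eq_empty_of_forall_notMem fun ω hω => hmin hω.1
      rw [this, measureReal_empty]
      exact hδ.1.le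
  set G := {ω | ∀ Phat : Matrix (Fin m) (Fin n) ℝ,
    OneBitMC.IsOutput σ τ γ (OneBitMC.mask (X ω)) Phat →
    1 / ((m : ℝ) * n) * ∑ u, ∑ i, (Phat u i - (A.map σ) u i) ^ 2 ≤
      4 * Real.exp 1 * OneBitMC.linkConst σ γ * τ * (1 / √(m : ℝ) + 1 / √(n : ℝ)) ∧
    ((∀ x ∈ Set.Icc (-γ) γ, σ (-γ) ≤ σ x) → (∀ x ∈ Set.Icc (-α) α, σ (-α) ≤ σ x) →
      |OneBitMC.ipsMSE (X ω) Shat Phat - OneBitMC.fullMSE (S + W) Shat| ≤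
        8 * ψ ^ 2 * √(Real.exp 1 * OneBitMC.linkConst σ γ * τ) / (σ (-γ) * σ (-α)) *
            (1 / (m : ℝ) ^ (1 / 4 : ℝ) + 1 / (n : ℝ) ^ (1 / 4 : ℝ)) +
          4 * ψ ^ 2 / σ (-α) * √(1 / (2 * (m : ℝ) * n) * Real.log (2 / δ)))} with hG
  -- Covering the whole space and using subadditivity gives the lower bound for `G` without its
  -- measurability.
  have hcover : Set.univ ⊆ G ∪ (B₁ ∪ B₂) := by
    intro ω _
    by_cases hω : ω ∈ B₁ ∪ B₂
    · exact Or.inr hω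
    refine Or.inl ?_
    rw [Set.mem_union, not_or] at hω
    rintro Phat ⟨Γ, hΓ, hmax, rfl⟩
    have hmse := OneBitMC.mse_le_of_not_deviationEvent hm hn hσ hA hΓ hmax hω.1
    refine ⟨hmse, fun hminγ hminα => ?_⟩
    -- The estimate depends on the same data as the loss, so this comparison is pointwise in `ω`;
    -- concentration is used only at the fixed `A.map σ`.
    have h1 := OneBitMC.abs_ipsMSE_sub_le hm hn (hX.eq_none_or ω) (P := A.map σ)
      (P' := Γ.map σ) (ψ := ψ) hcα hcγ (fun u i => hminα _ (hAα u i))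
      (fun u i => hminγ _ (OneBitMC.mem_Icc_of_maxNorm_le hΓ.2 u i)) hS
    have h2 : |OneBitMC.ipsMSE (X ω) Shat (A.map σ) - OneBitMC.fullMSE (S + W) Shat| ≤
        4 * ψ ^ 2 / σ (-α) * √(1 / (2 * (m : ℝ) * n) * Real.log (2 / δ)) :=
      not_lt.1 fun hlt => hω.2 ⟨hminα, hlt⟩
    have hL := OneBitMC.linkConst_nonneg hσ
    have h3 : √(1 / ((m : ℝ) * n) * ∑ u, ∑ i, ((Γ.map σ) u i - (A.map σ) u i) ^ 2) ≤
        2 * √(Real.exp 1 * OneBitMC.linkConst σ γ * τ) *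
          (1 / (m : ℝ) ^ (1 / 4 : ℝ) + 1 / (n : ℝ) ^ (1 / 4 : ℝ)) := by
      refine (Real.sqrt_le_sqrt hmse).trans ?_
      have h4 : 4 * Real.exp 1 * OneBitMC.linkConst σ γ * τ * (1 / √(m : ℝ) + 1 / √(n : ℝ)) =
          2 ^ 2 * (Real.exp 1 * OneBitMC.linkConst σ γ * τ) *
            (1 / √(m : ℝ) + 1 / √(n : ℝ)) := by ring
      rw [h4, Real.sqrt_mul (by positivity), Real.sqrt_mul (by positivity),
        Real.sqrt_sq (by norm_num)]
      exact mul_le_mul_of_nonneg_left (OneBitMC.sqrt_inv_sqrt_add_le m n) (by positivity)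
    have h5 := h1.trans (mul_le_mul_of_nonneg_left h3 (by positivity))
    refine (abs_sub_le _ (OneBitMC.ipsMSE (X ω) Shat (A.map σ)) _).trans
      (add_le_add (h5.trans (le_of_eq ?_)) h2)
    ring
  have h1 : (1 : ℝ) ≤ μ.real G + (μ.real B₁ + μ.real B₂) := by
    rw [← probReal_univ (μ := μ)]
    refine (measureReal_mono hcover (measure_ne_top _ _)).trans
      ((measureReal_union_le _ _).trans ?_)
    gcongr
    exact measureReal_union_le _ _
  linarith
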